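/- Let $k$ be a field and let $X$ be a finite group that factorises as $X=GM$ into two subgroups $G,M$, i.e. every element of $X$ is uniquely of the form $us$ with $u\in G$, $s\in M$. Define $s\triangleright u\in G$ and $s\triangleleft u\in M$ for $s\in M$, $u\in G$ by $su=(s\triangleright u)(s\triangleleft u)$. More generally, for a matched pair of finite groups $(\mathcal G,\mathcal M)$, i.e. a left action $\triangleright$ of $\mathcal M$ on the set $\mathcal G$ and a right action $\triangleleft$ of $\mathcal G$ on the set $\mathcal M$ satisfying $s\triangleright e=e$, $e\triangleleft u=e$, $s\triangleright(uv)=(s\triangleright u)((s\triangleleft u)\triangleright v)$ and $(st)\triangleleft u=(s\triangleleft(t\triangleright u))(t\triangleleft u)$, the bicrossproduct $k\mathcal M\,{\triangleright\!\!\!\blacktriangleleft}\,k(\mathcal G)$ is the Hopf algebra with basis $s\otimes\delta_u$ ($s\in\mathcal M$, $u\in\mathcal G$) and $$(s\otimes\delta_u)(t\otimes\delta_v)=\delta_{u,t\triangleright v}\,(st\otimes\delta_v),\quad 1=\sum_u e\otimes\delta_u,\quad \Delta(s\otimes\delta_u)=\sum_{xy=u}(s\otimes\delta_x)\otimes(s\triangleleft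 x\otimes\delta_y),$$ $$\epsilon(s\otimes\delta_u)=\delta_{u,e},\qquad S(s\otimes\delta_u)=(s\triangleleft u)^{-1}\otimes\delta_{(s\triangleright u)^{-1}}.$$ If $k$ has an involution, it carries the conjugate-linear $*$-structure $(s\otimes\delta_u)^*=s^{-1}\otimes\delta_{s\triangleright u}$. Let $H=kM\,{\triangleright\!\!\!\blacktriangleleft}\,k(G)$, and let $\delta_s\otimes u\in H^*$ denote the dual basis to $s\otimes\delta_u$. Let $D(H)=H^{*\rm op}\bowtie H$ be the quantum double: the vector space $H^*\otimes H$ with product $(\phi\otimes h)(\psi\otimes g)=\sum\langle Sh_{(1)},\psi_{(1)}\rangle\langle h_{(3)},\psi_{(3)}\rangle\,\psi_{(2)}\phi\otimes h_{(2)}g$ (where $\psi_{(2)}\phi$ is the product in $H^*$), unit $\epsilon\otimes 1$, the tensor product coalgebra structure, antipode $S(\phi\otimes h)=(1\otimes Sh)(\phi\circ S^{-1}\otimes 1)$ and, when $k$ has an involution, $(\phi\otimes h)^*=(1\otimes h^*)(\phi^*\otimes 1)$ with $\phi^*(h)=\overline{\phi((Sh)^*)}$. Let $Y=G\times M^{\rm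 op}$, and write $us$ for the element $(u,s)$ of $Y$, so that the group law of $Y$ is $(us)\cdot(vt)=uvts$. As a set $Y$ is identified with $X$. Then $Y$ and $X$ form a matched pair under the actions, for $us\in X$ and $vt\in Y$ ($u,v\in G$, $s,t\in M$), $$us\,\tilde\triangleright\,vt=us(vt)(us)^{-1}\ \text{(computed in $X$)},\qquad us\,\tilde\triangleleft\,vt=\big((s\triangleleft v)ts^{-1}\triangleright u^{-1}\big)^{-1}(s\triangleleft v)\in X,$$ and $kX\,{\triangleright\!\!\!\blacktriangleleft}\,k(Y)$ denotes the resulting bicrossproduct. **Theorem.** There is an isomorphism of Hopf algebras $\psi:D(H)\to kX\,{\triangleright\!\!\!\blacktriangleleft}\,k(Y)$ given by $$\psi(\delta_s\otimes u\otimes t\otimes\delta_v)=(s\triangleright u)^{-1}t\otimes\delta_{v(t\triangleleft v)^{-1}s^{-1}t}\qquad(s,t\in M,\ u,v\in G),$$ where $(s\triangleright u)^{-1}t\in X$ and $v(t\triangleleft v)^{-1}s^{-1}t$ denotes the element $\big(v,(t\triangleleft v)^{-1}s^{-1}t\big)$ of $Y$. That is, $\psi$ is a linear bijection that preserves product, unit,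 coproduct, counit and antipode. Moreover, for every involution of the field $k$, $\psi$ preserves the $*$-operation. -/

import Mathlib

open scoped TensorProduct

/-! ### Matched pairs and factorisations of groups -/

/-- A (left-right) matched pair of groups: `lact s u` is `s ▹ u ∈ G` and `ract s u` is `s ◃ u ∈ M`,
for `s ∈ M` and `u ∈ G`. -/
structure MatchedPair (G M : Type*) [Group G] [Group M] where
  lact : M → G → G
  ract : M → G → M
  ract_one : ∀ s, ract s 1 = s
  ract_ract : ∀ s u v, ract (ract s u) v = ract s (u * v)
  one_ract : ∀ u, ract 1 u = 1
  mul_ract : ∀ s t u, ract (s * t) u = ract s (lact t u) * ract t u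
  one_lact : ∀ u, lact 1 u = u
  lact_lact : ∀ s t u, lact s (lact t u) = lact (s * t) u
  lact_one : ∀ s, lact s 1 = 1
  lact_mul : ∀ s u v, lact s (u * v) = lact s u * lact (ract s u) v

namespace GroupFactorisation

variable {X : Type*} [Group X] {G M : Subgroup X} (h : G.IsComplement' M)

/-- The `G`-component of `x ∈ X = GM`. -/
noncomputable def factG (x : X) : G := (Subgroup.IsComplement.equiv h x).1

/-- The `M`-component of `x ∈ X = GM`. -/
noncomputable def factM (x : X) : M := (Subgroup.IsComplement.equiv h x).2

theorem factG_mul_factM (x : X) : (factG h x : X) * (factM h x : X) = x :=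
  Subgroup.IsComplement.equiv_fst_mul_equiv_snd h x

theorem fact_unique (h : G.IsComplement' M) {u v : G} {s t : M} (e : (u : X) * s = v * t) : u = v ∧ s = t := by
  have := (Subgroup.IsComplement.equiv h).symm.injective (a₁ := (u, s)) (a₂ := (v, t)) e
  exact Prod.ext_iff.mp this

theorem fact_eq {x : X} {u : G} {s : M} (e : (u : X) * s = x) :
    factG h x = u ∧ factM h x = s :=
  fact_unique h (by rw [factG_mul_factM, e])

/-- The matched pair of a factorisation `X = GM`, determined by `s u = (s ▹ u)(s ◃ u)`. -/
noncomputable def matchedPair : MatchedPair G M where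
  lact s u := factG h ((s : X) * u)
  ract s u := factM h ((s : X) * u)
  ract_one s := (fact_eq h (u := 1) (by simp)).2
  ract_ract s u v := by
    refine (fact_eq h (u := (factG h ((s : X) * u))⁻¹ * factG h ((s : X) * (u * v : G))) ?_).2
    have h1 := factG_mul_factM h ((s : X) * (u * v : G))
    have h2 := factG_mul_factM h ((s : X) * u)
    push_cast at h1 ⊢
    rw [mul_assoc, h1, ← mul_assoc (s : X), eq_mul_inv_of_mul_eq h2]; group
  one_ract u := (fact_eq h (u := u) (by simp)).2
  mul_ract s t u := by
    refine (fact_eq h (u := factG h ((s : X) * factG h ((t : X) * u))) ?_).2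
    have h1 := factG_mul_factM h ((s : X) * factG h ((t : X) * u))
    have h2 := factG_mul_factM h ((t : X) * u)
    push_cast
    rw [← mul_assoc, h1, mul_assoc, h2, mul_assoc]
  one_lact u := (fact_eq h (s := 1) (by simp)).1
  lact_lact s t u := by
    refine (fact_eq h (s := factM h (((s * t : M) : X) * u) * (factM h ((t : X) * u))⁻¹) ?_).1
    have h1 := factG_mul_factM h (((s * t : M) : X) * u)
    have h2 := factG_mul_factM h ((t : X) * u)
    push_cast at h1 ⊢
    rw [← mul_assoc, h1, mul_assoc (s : X), eq_inv_mul_of_mul_eq h2]; group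
  lact_one s := (fact_eq h (s := s) (by simp)).1
  lact_mul s u v := by
    have h2 := factG_mul_factM h ((s : X) * u)
    have h3 := factG_mul_factM h ((factM h ((s : X) * u) : X) * v)
    refine (fact_eq h (s := factM h ((factM h ((s : X) * u) : X) * v)) ?_).1
    push_cast
    rw [mul_assoc, h3, ← mul_assoc, h2, mul_assoc]

theorem lact_mul_ract (s : M) (u : G) :
    ((matchedPair h).lact s u : X) * ((matchedPair h).ract s u : X) = s * u :=
  factG_mul_factM h _

/-- The element `u s ∈ X` underlying `(u, s) ∈ Y = G × Mᵐᵒᵖ`. -/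
def toX (y : G × Mᵐᵒᵖ) : X := (y.1 : X) * (y.2.unop : X)

/-- The bijection of sets `X → Y = G × Mᵐᵒᵖ`, `u s ↦ (u, s)`. -/
noncomputable def toY (x : X) : G × Mᵐᵒᵖ := (factG h x, MulOpposite.op (factM h x))

theorem toX_toY (x : X) : toX (toY h x) = x := factG_mul_factM h x

theorem toY_toX (y : G × Mᵐᵒᵖ) : toY h (toX y) = y := by
  have := fact_eq h (x := toX y) (u := y.1) (s := y.2.unop) rfl
  ext1 <;> simp [toY, this]

/-- The left action of `X` on the set `Y`: conjugation in `X`. -/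
noncomputable def dressL (x : X) (y : G × Mᵐᵒᵖ) : G × Mᵐᵒᵖ := toY h (x * toX y * x⁻¹)

/-- The right action of `Y` on the set `X`:
`us ◃ (v,t) = ((s ◃ v) t s⁻¹ ▹ u⁻¹)⁻¹ (s ◃ v)`. -/
noncomputable def dressR (x : X) (y : G × Mᵐᵒᵖ) : X :=
  let P := matchedPair h
  let u := factG h x
  let s := factM h x
  let v := y.1
  let t := y.2.unop
  ((P.lact (P.ract s v * t * s⁻¹) u⁻¹ : G) : X)⁻¹ * (P.ract s v : X)

theorem dressR_eq (x : X) (y : G × Mᵐᵒᵖ) :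
    dressR h x y = ((dressL h x y).1 : X)⁻¹ * x * y.1 := by
  obtain ⟨v, t⟩ := y
  set P := matchedPair h with hP
  set u := factG h x with hu
  set s := factM h x with hs
  have hx : (u : X) * s = x := factG_mul_factM h x
  have h1 := lact_mul_ract h s v
  have h2 := lact_mul_ract h (P.ract s v * t.unop * s⁻¹) u⁻¹
  rw [← hP] at h1 h2
  have key : (dressL h x (v, t)).1 = u * P.lact s v * P.lact (P.ract s v * t.unop * s⁻¹) u⁻¹ := by
    refine (fact_eq h (s := P.ract (P.ract s v * t.unop * s⁻¹) u⁻¹) ?_).1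
    push_cast at h2 ⊢
    rw [mul_assoc, h2, ← hx]
    have : (P.ract s v : X) = (P.lact s v : X)⁻¹ * (s * v) := by rw [← h1]; group
    rw [this, toX]; group
  rw [key]
  change ((P.lact (P.ract s v * t.unop * s⁻¹) u⁻¹ : G) : X)⁻¹ * (P.ract s v : X) = _
  have : (P.ract s v : X) = (P.lact s v : X)⁻¹ * (s * v) := by rw [← h1]; group
  push_cast
  rw [this]
  simp only [← hx]
  group

theorem toX_mul (y z : G × Mᵐᵒᵖ) : toX (y * z) = y.1 * toX z * y.2.unop := by
  simp [toX, mul_assoc]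

theorem toX_dressL (x : X) (y : G × Mᵐᵒᵖ) : toX (dressL h x y) = x * toX y * x⁻¹ :=
  toX_toY h _

theorem snd_eq (y : G × Mᵐᵒᵖ) : (y.2.unop : X) = (y.1 : X)⁻¹ * toX y := by
  simp [toX]

theorem toX_injective (h : G.IsComplement' M) : Function.Injective (toX : G × Mᵐᵒᵖ → X) :=
  Function.LeftInverse.injective (toY_toX h)

theorem dressL_mul (x : X) (y z : G × Mᵐᵒᵖ) :
    dressL h x (y * z) = dressL h x y * dressL h (dressR h x y) z := by
  apply toX_injective h
  rw [toX_mul, snd_eq, toX_dressL, toX_dressL, toX_dressL, dressR_eq, toX_mul, snd_eq]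
  group

/-- The matched pair of `Y = G × Mᵐᵒᵖ` (group law `(us)(vt) = uvts`) and `X`, whose double cross
product is `Y ⋈ X`. -/
noncomputable def dressingPair : MatchedPair (G × Mᵐᵒᵖ) X where
  lact := dressL h
  ract := dressR h
  ract_one x := by
    have : dressL h x 1 = 1 := by
      apply toX_injective h; rw [toX_dressL]; simp [toX]
    rw [dressR_eq, this]; simp
  ract_ract x y z := by
    rw [dressR_eq, dressR_eq h x (y * z), dressL_mul, dressR_eq]
    simp only [Prod.fst_mul, Subgroup.coe_mul]
    group
  one_ract y := by
    have : dressL h 1 y = y := by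
      apply toX_injective h; rw [toX_dressL]; simp
    rw [dressR_eq, this]; simp
  mul_ract x x' y := by
    have : dressL h (x * x') y = dressL h x (dressL h x' y) := by
      apply toX_injective h; simp only [toX_dressL]; group
    rw [dressR_eq, dressR_eq, dressR_eq, this]; group
  one_lact y := by
    apply toX_injective h; rw [toX_dressL]; simp
  lact_lact x x' y := by
    apply toX_injective h; simp only [toX_dressL]; group
  lact_one x := by
    apply toX_injective h; rw [toX_dressL]; simp [toX]
  lact_mul x y z := dressL_mul h x y z

instance {α : Type*} [Finite α] : Finite αᵐᵒᵖ := Finite.of_equiv α MulOpposite.opEquiv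

end GroupFactorisation

/-! ### Bicrossproduct Hopf algebras -/

/-- The bicrossproduct `kM ▷◀ k(G)` of a matched pair: the vector space with basis
`s ⊗ δ_u`, for `s ∈ M` and `u ∈ G`. -/
def Bicross (k : Type*) [Field k] {G M : Type*} [Group G] [Group M]
    (_P : MatchedPair G M) : Type _ := (M × G) →₀ k

namespace Bicross

variable {k : Type*} [Field k] {G M : Type*} [Group G] [Group M] (P : MatchedPair G M)

theorem lact_inv_lact (s : M) (u : G) : P.lact (P.ract s u)⁻¹ (P.lact s u)⁻¹ = u⁻¹ := by
  have h : P.lact (P.ract s u) u⁻¹ = (P.lact s u)⁻¹ := by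
    rw [eq_comm, inv_eq_iff_mul_eq_one, ← P.lact_mul, mul_inv_cancel, P.lact_one]
  rw [← h, P.lact_lact, inv_mul_cancel, P.one_lact]

theorem ract_inv_lact (s : M) (u : G) : P.ract (P.ract s u)⁻¹ (P.lact s u)⁻¹ = s⁻¹ := by
  have h : P.lact (P.ract s u) u⁻¹ = (P.lact s u)⁻¹ := by
    rw [eq_comm, inv_eq_iff_mul_eq_one, ← P.lact_mul, mul_inv_cancel, P.lact_one]
  have h2 : P.ract ((P.ract s u)⁻¹ * P.ract s u) u⁻¹ = 1 := by
    rw [inv_mul_cancel, P.one_ract]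
  rw [P.mul_ract, h, P.ract_ract, mul_inv_cancel, P.ract_one] at h2
  exact eq_inv_of_mul_eq_one_left h2

noncomputable instance : AddCommGroup (Bicross k P) := inferInstanceAs (AddCommGroup ((M × G) →₀ k))

noncomputable instance : Module k (Bicross k P) := inferInstanceAs (Module k ((M × G) →₀ k))

/-- The basis `s ⊗ δ_u`, indexed by `(s, u)`. -/
noncomputable def basis : Module.Basis (M × G) k (Bicross k P) :=
  ⟨LinearEquiv.refl k ((M × G) →₀ k)⟩

/-- The basis element `s ⊗ δ_u`. -/
noncomputable def of (s : M) (u : G) : Bicross k P := basis P (s, u)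

theorem basis_apply (p : M × G) : basis P p = (of P p.1 p.2 : Bicross k P) := rfl

theorem induct {C : Bicross k P → Prop} (zero : C 0) (add : ∀ a b, C a → C b → C (a + b))
    (smul : ∀ (c : k) a, C a → C (c • a)) (single : ∀ p : M × G, C (of P p.1 p.2)) (a) : C a := by
  have := (basis P).mem_span a
  induction this using Submodule.span_induction with
  | mem x hx => obtain ⟨p, rfl⟩ := hx; exact single p
  | zero => exact zero
  | add x y _ _ hx hy => exact add x y hx hy
  | smul c x _ hx => exact smul c x hx

instance [Finite G] [Finite M] : Module.Finite k (Bicross k P) := Module.Finite.of_basis (basis P)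

open Classical in
/-- The product `(s ⊗ δ_u)(t ⊗ δ_v) = δ_{u, t ▹ v} (st ⊗ δ_v)`. -/
noncomputable def mulMap : Bicross k P →ₗ[k] Bicross k P →ₗ[k] Bicross k P :=
  (basis P).constr k fun p => (basis P).constr k fun q =>
    if p.2 = P.lact q.1 q.2 then of P (p.1 * q.1) q.2 else 0

noncomputable instance : Mul (Bicross k P) := ⟨fun a b => mulMap P a b⟩

theorem mul_def (a b : Bicross k P) : a * b = mulMap P a b := rfl

open Classical in
theorem of_mul_of (s t : M) (u v : G) :
    (of P s u * of P t v : Bicross k P) = if u = P.lact t v then of P (s * t) v else 0 := by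
  simp [mul_def, mulMap, of, Module.Basis.constr_basis]

/-- The unit `∑ u, e ⊗ δ_u`. -/
noncomputable instance [Finite G] : One (Bicross k P) :=
  ⟨letI := Fintype.ofFinite G; ∑ u : G, of P 1 u⟩

theorem one_def [Fintype G] : (1 : Bicross k P) = ∑ u : G, of P 1 u := by
  change (@Finset.sum _ _ _ (@Finset.univ G (Fintype.ofFinite G)) _) = _
  congr!

theorem mul_assoc' (a b c : Bicross k P) : a * b * c = a * (b * c) := by
  classical
  have : (mulMap P).compr₂ (mulMap P) = (LinearMap.llcomp k _ _ _).flip (mulMap P) ∘ₗ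
      (LinearMap.llcomp k (Bicross k P) _ _) ∘ₗ (mulMap P) := by
    refine (basis P).ext fun p => (basis P).ext fun q => (basis P).ext fun r => ?_
    change of P p.1 p.2 * of P q.1 q.2 * of P r.1 r.2 =
      of P p.1 p.2 * (of P q.1 q.2 * of P r.1 r.2)
    rw [of_mul_of, of_mul_of]
    by_cases h2 : q.2 = P.lact r.1 r.2
    · by_cases h1 : p.2 = P.lact q.1 q.2
      · rw [if_pos h1, if_pos h2, of_mul_of, of_mul_of, if_pos h2, if_pos, mul_assoc]
        rw [h1, h2, P.lact_lact]
      · rw [if_neg h1, if_pos h2, of_mul_of, if_neg, mul_def]; · simp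
        rw [← P.lact_lact, ← h2]; exact h1
    · rw [if_neg h2]
      by_cases h1 : p.2 = P.lact q.1 q.2
      · rw [if_pos h1, of_mul_of, if_neg h2]; simp [mul_def]
      · rw [if_neg h1]; simp [mul_def]
  exact congr($this a b c)

theorem one_mul' [Finite G] (a : Bicross k P) : 1 * a = a := by
  classical
  have := Fintype.ofFinite G
  have : mulMap P (1 : Bicross k P) = LinearMap.id := by
    refine (basis P).ext fun p => ?_
    change 1 * (of P p.1 p.2 : Bicross k P) = of P p.1 p.2
    rw [one_def, mul_def, map_sum, LinearMap.sum_apply]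
    simp only [← mul_def, of_mul_of]
    simp
  exact congr($this a)

theorem mul_one' [Finite G] (a : Bicross k P) : a * 1 = a := by
  classical
  have := Fintype.ofFinite G
  have : (mulMap P).flip (1 : Bicross k P) = LinearMap.id := by
    refine (basis P).ext fun p => ?_
    change (of P p.1 p.2 : Bicross k P) * 1 = of P p.1 p.2
    rw [one_def, mul_def, map_sum]
    simp only [← mul_def, of_mul_of]
    simp [P.one_lact]
  exact congr($this a)

noncomputable instance [Finite G] : Ring (Bicross k P) :=
  { (inferInstance : AddCommGroup (Bicross k P)) with
    mul := (· * ·)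
    one := 1
    mul_assoc := mul_assoc' P
    one_mul := one_mul' P
    mul_one := mul_one' P
    left_distrib := fun a b c => by simp [mul_def]
    right_distrib := fun a b c => by simp [mul_def]
    zero_mul := fun a => by simp [mul_def]
    mul_zero := fun a => by simp [mul_def] }

noncomputable instance [Finite G] : Algebra k (Bicross k P) :=
  Algebra.ofModule (fun r a b => by simp [mul_def]) (fun r a b => by simp [mul_def])

section

variable [Finite G]

/-- The coproduct `Δ(s ⊗ δ_u) = ∑_{xy = u} (s ⊗ δ_x) ⊗ (s ◃ x ⊗ δ_y)` (with `y = x⁻¹u`) and the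
counit `ε(s ⊗ δ_u) = δ_{u,e}`. -/
noncomputable instance : CoalgebraStruct k (Bicross k P) where
  comul := letI := Fintype.ofFinite G
    (basis P).constr k fun p => ∑ x : G, of P p.1 x ⊗ₜ[k] of P (P.ract p.1 x) (x⁻¹ * p.2)
  counit := open Classical in (basis P).constr k fun p => if p.2 = 1 then 1 else 0

open Coalgebra

theorem comul_of [Fintype G] (s : M) (u : G) :
    comul (R := k) (of P s u : Bicross k P) =
      ∑ x : G, of P s x ⊗ₜ[k] of P (P.ract s x) (x⁻¹ * u) := by
  change (basis P).constr k _ (basis P (s, u)) = _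
  rw [Module.Basis.constr_basis]
  congr!

open Classical in
theorem counit_of (s : M) (u : G) :
    counit (R := k) (of P s u : Bicross k P) = if u = 1 then 1 else 0 := by
  change (basis P).constr k _ (basis P (s, u)) = _
  rw [Module.Basis.constr_basis]

noncomputable instance : Coalgebra k (Bicross k P) where
  coassoc := by
    have := Fintype.ofFinite G
    refine (basis P).ext fun p => ?_
    simp only [basis_apply, LinearMap.comp_apply, comul_of, map_sum, LinearMap.rTensor_tmul,
      LinearMap.lTensor_tmul, LinearEquiv.coe_coe, TensorProduct.sum_tmul, TensorProduct.tmul_sum,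
      TensorProduct.assoc_tmul]
    rw [Finset.sum_comm]
    refine Finset.sum_congr rfl fun x _ => ?_
    refine (Fintype.sum_equiv (Equiv.mulLeft x) _ _ fun y => ?_).symm
    simp [P.ract_ract, mul_assoc]
  rTensor_counit_comp_comul := by
    classical
    have := Fintype.ofFinite G
    refine (basis P).ext fun p => ?_
    simp only [basis_apply, LinearMap.comp_apply, comul_of, map_sum, LinearMap.rTensor_tmul,
      counit_of]
    rw [Finset.sum_eq_single 1]
    · simp [P.ract_one]
    · intro b _ hb; simp [hb]
    · simp
  lTensor_counit_comp_comul := by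
    classical
    have := Fintype.ofFinite G
    refine (basis P).ext fun p => ?_
    simp only [basis_apply, LinearMap.comp_apply, comul_of, map_sum, LinearMap.lTensor_tmul,
      counit_of]
    rw [Finset.sum_eq_single p.2]
    · simp
    · intro b _ hb
      rw [if_neg]; · simp
      rw [inv_mul_eq_one]; exact hb
    · simp

noncomputable instance : Bialgebra k (Bicross k P) where
  counit_one := by
    classical
    have := Fintype.ofFinite G
    simp [one_def, counit_of]
  mul_compr₂_counit := by
    classical
    refine (basis P).ext fun p => (basis P).ext fun q => ?_
    simp only [basis_apply, LinearMap.compr₂_apply, LinearMap.compl₁₂_apply, LinearMap.mul_apply',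
      of_mul_of, counit_of]
    by_cases h : q.2 = 1
    · simp only [h, P.lact_one]
      split_ifs <;> simp_all [counit_of]
    · split_ifs <;> simp_all [counit_of]
  comul_one := by
    have := Fintype.ofFinite G
    simp only [one_def, map_sum, comul_of, Algebra.TensorProduct.one_def, TensorProduct.sum_tmul,
      TensorProduct.tmul_sum, P.one_ract]
    rw [Finset.sum_comm]
    conv_rhs => rw [Finset.sum_comm]
    refine Finset.sum_congr rfl fun x _ => ?_
    exact Fintype.sum_equiv (Equiv.mulLeft x⁻¹) _ _ fun y => by simp
  mul_compr₂_comul := by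
    classical
    have := Fintype.ofFinite G
    refine (basis P).ext fun p => (basis P).ext fun q => ?_
    obtain ⟨s, u⟩ := p
    obtain ⟨t, v⟩ := q
    simp only [basis_apply, LinearMap.compr₂_apply, LinearMap.compl₁₂_apply, LinearMap.mul_apply',
      of_mul_of, comul_of, Finset.sum_mul_sum, Algebra.TensorProduct.tmul_mul_tmul]
    rw [Finset.sum_comm]
    have key : ∀ y : G, P.lact t v = P.lact t y * P.lact (P.ract t y) (y⁻¹ * v) := fun y => by
      rw [← P.lact_mul]; simp
    have : ∀ y : G, (∑ x : G, (if x = P.lact t y then (of P (s * t) y : Bicross k P) else 0) ⊗ₜ[k]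
        if x⁻¹ * u = P.lact (P.ract t y) (y⁻¹ * v) then
          (of P (P.ract s x * P.ract t y) (y⁻¹ * v) : Bicross k P) else 0) =
        if u = P.lact t v then
          of P (s * t) y ⊗ₜ[k] of P (P.ract (s * t) y) (y⁻¹ * v) else 0 := by
      intro y
      rw [Finset.sum_eq_single (P.lact t y)]
      · rw [if_pos rfl, P.mul_ract, key y]
        simp only [inv_mul_eq_iff_eq_mul]
        split_ifs <;> simp
      · intro b _ hb; simp [hb]
      · simp
    simp only [this]
    split_ifs <;> simp [comul_of]

/-- The antipode `S(s ⊗ δ_u) = (s ◃ u)⁻¹ ⊗ δ_{(s ▹ u)⁻¹}`. -/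
noncomputable instance : HopfAlgebraStruct k (Bicross k P) where
  antipode := (basis P).constr k fun p => of P (P.ract p.1 p.2)⁻¹ (P.lact p.1 p.2)⁻¹

theorem antipode_of (s : M) (u : G) :
    HopfAlgebra.antipode k (of P s u : Bicross k P) = of P (P.ract s u)⁻¹ (P.lact s u)⁻¹ := by
  change (basis P).constr k _ (basis P (s, u)) = _
  rw [Module.Basis.constr_basis]

noncomputable instance : HopfAlgebra k (Bicross k P) where
  mul_antipode_rTensor_comul := by
    classical
    have := Fintype.ofFinite G
    refine (basis P).ext fun p => ?_
    obtain ⟨s, u⟩ := p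
    simp only [basis_apply, LinearMap.comp_apply, comul_of, map_sum, LinearMap.rTensor_tmul,
      antipode_of, LinearMap.mul'_apply, of_mul_of, counit_of]
    have : ∀ x : G, ((P.lact s x)⁻¹ = P.lact (P.ract s x) (x⁻¹ * u)) ↔ u = 1 := by
      intro x
      rw [inv_eq_iff_mul_eq_one, ← P.lact_mul, mul_inv_cancel_left]
      constructor
      · intro h
        rw [← P.one_lact u, ← inv_mul_cancel s, ← P.lact_lact, h, P.lact_one]
      · rintro rfl; exact P.lact_one s
    simp only [this]
    split_ifs with h
    · subst h
      simp only [inv_mul_cancel, mul_one, Algebra.linearMap_apply, map_one, one_def]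
      exact Fintype.sum_equiv (Equiv.inv G) _ _ fun y => by simp
    · simp
  mul_antipode_lTensor_comul := by
    classical
    have := Fintype.ofFinite G
    refine (basis P).ext fun p => ?_
    obtain ⟨s, u⟩ := p
    simp only [basis_apply, LinearMap.comp_apply, comul_of, map_sum, LinearMap.lTensor_tmul,
      antipode_of, LinearMap.mul'_apply, of_mul_of, counit_of, P.ract_ract, mul_inv_cancel_left]
    have h1 : ∀ x : G, P.lact (P.ract s u)⁻¹ (P.lact (P.ract s x) (x⁻¹ * u))⁻¹ = u⁻¹ * x := by
      intro x
      have : (P.lact (P.ract s x) (x⁻¹ * u))⁻¹ = (P.lact s u)⁻¹ * P.lact s x := by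
        rw [inv_eq_iff_eq_inv, mul_inv_rev, inv_inv, eq_inv_mul_iff_mul_eq, ← P.lact_mul,
          mul_inv_cancel_left]
      rw [this, P.lact_mul, lact_inv_lact, ract_inv_lact, P.lact_lact, inv_mul_cancel, P.one_lact]
    have : ∀ x : G, (x = u⁻¹ * x) ↔ u = 1 := by
      intro x
      rw [eq_comm, mul_eq_right, inv_eq_one]
    simp only [h1, this]
    split_ifs with h
    · subst h
      have h2 : ∀ x : G, P.lact (P.ract s x) x⁻¹ = (P.lact s x)⁻¹ := fun x => by
        rw [eq_comm, inv_eq_iff_mul_eq_one, ← P.lact_mul, mul_inv_cancel, P.lact_one]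
      simp only [P.ract_one, mul_inv_cancel, mul_one, h2, inv_inv, Algebra.linearMap_apply,
        map_one, one_def]
      refine Fintype.sum_equiv ⟨P.lact s, P.lact s⁻¹, fun x => ?_, fun x => ?_⟩ _ _ fun y => rfl
      · rw [P.lact_lact, inv_mul_cancel, P.one_lact]
      · rw [P.lact_lact, mul_inv_cancel, P.one_lact]
    · simp

end

section

variable [StarRing k]

/-- The permutation `(s, u) ↦ (s⁻¹, s ▹ u)` of the basis. -/
def starPerm : Equiv.Perm (M × G) where
  toFun p := (p.1⁻¹, P.lact p.1 p.2)
  invFun p := (p.1⁻¹, P.lact p.1 p.2)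
  left_inv p := by simp [P.lact_lact, P.one_lact]
  right_inv p := by simp [P.lact_lact, P.one_lact]

/-- The conjugate-linear involution with `(s ⊗ δ_u)^* = s⁻¹ ⊗ δ_{s ▹ u}`. -/
noncomputable instance : Star (Bicross k P) :=
  ⟨fun a => (basis P).repr.symm (Finsupp.equivMapDomain (starPerm P)
    (Finsupp.mapRange star (star_zero k) ((basis P).repr a)))⟩

theorem star_apply (a : Bicross k P) (p : M × G) :
    (basis P).repr (star a) p = star ((basis P).repr a (starPerm P p)) := rfl

theorem star_add' (a b : Bicross k P) : star (a + b) = star a + star b :=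
  (basis P).ext_elem fun p => by simp [star_apply]

theorem star_smul' (c : k) (a : Bicross k P) : star (c • a) = star c • star a :=
  (basis P).ext_elem fun p => by simp [star_apply]

theorem star_of (s : M) (u : G) :
    star (of P s u : Bicross k P) = of P s⁻¹ (P.lact s u) := by
  change (basis P).repr.symm (Finsupp.equivMapDomain (starPerm P)
    (Finsupp.mapRange star (star_zero k) ((basis P).repr (basis P (s, u))))) = _
  rw [Module.Basis.repr_self, Finsupp.mapRange_single, Finsupp.equivMapDomain_single,
    star_one, Module.Basis.repr_symm_single_one]
  rfl

noncomputable instance [Finite G] : StarRing (Bicross k P) where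
  star_involutive a := (basis P).ext_elem fun p => by
    rw [star_apply, star_apply, star_star]
    exact congrArg _ ((starPerm P).left_inv p)
  star_add := star_add' P
  star_mul a b := by
    classical
    have h0 : star (0 : Bicross k P) = 0 := by
      have := star_add' P (0 : Bicross k P) 0
      simpa using this
    induction a using induct P with
    | zero => simp [h0]
    | add a a' ha ha' => rw [add_mul, star_add', ha, ha', star_add', mul_add]
    | smul c a ha => rw [smul_mul_assoc, star_smul', ha, star_smul', mul_smul_comm]
    | single p =>
      induction b using induct P with
      | zero => simp [h0]
      | add a a' ha ha' => rw [mul_add, star_add', ha, ha', star_add', add_mul]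
      | smul c a ha => rw [mul_smul_comm, star_smul', ha, star_smul', smul_mul_assoc]
      | single q =>
        simp only [of_mul_of, star_of, P.lact_lact, inv_mul_cancel, P.one_lact]
        by_cases h : p.2 = P.lact q.1 q.2
        · rw [if_pos h, if_pos h.symm, star_of, mul_inv_rev, h, P.lact_lact]
        · rw [if_neg h, if_neg (Ne.symm h), h0]

instance [Finite G] : StarModule k (Bicross k P) := ⟨star_smul' P⟩

end

end Bicross

/-! ### The quantum double `D(H) = H^{*op} ⋈ H` -/

/-- The quantum double of a finite-dimensional Hopf algebra `H`, built on `H^* ⊗ H`. -/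
def QuantumDouble (k H : Type*) [Field k] [AddCommGroup H] [Module k H] : Type _ :=
  Module.Dual k H ⊗[k] H

namespace QuantumDouble

open Coalgebra

section

variable (k H : Type*) [Field k] [AddCommGroup H] [Module k H]

noncomputable instance : AddCommGroup (QuantumDouble k H) :=
  inferInstanceAs (AddCommGroup (Module.Dual k H ⊗[k] H))

noncomputable instance : Module k (QuantumDouble k H) :=
  inferInstanceAs (Module k (Module.Dual k H ⊗[k] H))

/-- The identification of `H^* ⊗ H` with the underlying space of `D(H)`. -/
noncomputable def ofTensor : Module.Dual k H ⊗[k] H ≃ₗ[k] QuantumDouble k H :=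
  LinearEquiv.refl k (Module.Dual k H ⊗[k] H)

variable {k H} in
/-- The element `φ ⊗ h` of `D(H)`. -/
noncomputable def tmul (φ : Module.Dual k H) (h : H) : QuantumDouble k H :=
  ofTensor k H (φ ⊗ₜ[k] h)

variable {k H} in
/-- The linear map out of `D(H) = H^* ⊗ H` given by a bilinear map. -/
noncomputable def lift {N : Type*} [AddCommGroup N] [Module k N]
    (f : Module.Dual k H →ₗ[k] H →ₗ[k] N) : QuantumDouble k H →ₗ[k] N :=
  TensorProduct.lift f ∘ₗ (ofTensor k H).symm.toLinearMap

variable {k H} in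
@[simp]
theorem lift_tmul {N : Type*} [AddCommGroup N] [Module k N]
    (f : Module.Dual k H →ₗ[k] H →ₗ[k] N) (φ : Module.Dual k H) (h : H) :
    lift f (tmul φ h) = f φ h := rfl

variable {k H} in
theorem hom_ext {N : Type*} [AddCommGroup N] [Module k N]
    {f g : QuantumDouble k H →ₗ[k] N} (e : ∀ φ h, f (tmul φ h) = g (tmul φ h)) : f = g :=
  TensorProduct.ext' (g := (f : Module.Dual k H ⊗[k] H →ₗ[k] N)) e

end

section

variable (k H : Type*) [Field k] [Ring H] [HopfAlgebra k H]

/-- The product of `H^*`: `(φ ψ)(h) = φ(h₁) ψ(h₂)`. -/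
noncomputable def dualMul : Module.Dual k H →ₗ[k] Module.Dual k H →ₗ[k] Module.Dual k H :=
  LinearMap.mk₂ k (fun φ ψ => LinearMap.mul' k k ∘ₗ TensorProduct.map φ ψ ∘ₗ comul)
    (fun _ _ _ => by
      rw [TensorProduct.map_add_left, LinearMap.add_comp, LinearMap.comp_add])
    (fun _ _ _ => by
      rw [TensorProduct.map_smul_left, LinearMap.smul_comp, LinearMap.comp_smul])
    (fun _ _ _ => by
      rw [TensorProduct.map_add_right, LinearMap.add_comp, LinearMap.comp_add])
    (fun _ _ _ => by
      rw [TensorProduct.map_smul_right, LinearMap.smul_comp, LinearMap.comp_smul])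

variable {k H} in
/-- For a functional `ψ`, the map sending `a` and `b` to the functional `x ↦ ψ(S(a) x b)`. -/
noncomputable def sandwich (ψ : Module.Dual k H) : H →ₗ[k] H →ₗ[k] Module.Dual k H :=
  LinearMap.mk₂ k (fun a b => ψ ∘ₗ LinearMap.mulLeft k (HopfAlgebra.antipode k a) ∘ₗ
      LinearMap.mulRight k b)
    (fun _ _ _ => by ext; simp [add_mul])
    (fun _ _ _ => by ext; simp)
    (fun _ _ _ => by ext; simp [mul_add])
    (fun _ _ _ => by ext; simp)

/-- The reordering `(1 ⊗ h)(ψ ⊗ 1) = ψ(S(h₁) ( ) h₃) ⊗ h₂`, i.e.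
`⟨S(h₁), ψ₁⟩ ⟨h₃, ψ₃⟩ ψ₂ ⊗ h₂`. -/
noncomputable def cross : Module.Dual k H →ₗ[k] H →ₗ[k] Module.Dual k H ⊗[k] H where
  toFun ψ := (TensorProduct.lift (sandwich ψ)).rTensor H ∘ₗ
    (TensorProduct.assoc k H H H).symm.toLinearMap ∘ₗ
    (TensorProduct.comm k H H).toLinearMap.lTensor H ∘ₗ comul.lTensor H ∘ₗ comul
  map_add' ψ ψ' := by
    have : TensorProduct.lift (sandwich (ψ + ψ')) =
        TensorProduct.lift (sandwich ψ) + TensorProduct.lift (sandwich ψ') := by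
      ext; simp [sandwich]
    rw [this, LinearMap.rTensor_add, LinearMap.add_comp]
  map_smul' c ψ := by
    have : TensorProduct.lift (sandwich (c • ψ)) = c • TensorProduct.lift (sandwich ψ) := by
      ext; simp [sandwich]
    rw [this, LinearMap.rTensor_smul, LinearMap.smul_comp]; rfl

/-- The product of `D(H)`:
`(φ ⊗ h)(ψ ⊗ g) = ⟨S(h₁), ψ₁⟩ ⟨h₃, ψ₃⟩ ψ₂ φ ⊗ h₂ g`, with `ψ₂ φ` computed in `H^*`. -/
noncomputable def mulMap :
    QuantumDouble k H →ₗ[k] QuantumDouble k H →ₗ[k] QuantumDouble k H :=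
  lift (LinearMap.mk₂ k
    (fun φ h => lift (LinearMap.mk₂ k
      (fun ψ g => ofTensor k H (TensorProduct.map ((dualMul k H).flip φ) (LinearMap.mulRight k g)
        (cross k H ψ h)))
      (fun _ _ _ => by simp)
      (fun _ _ _ => by simp)
      (fun _ _ _ => by
        rw [show ∀ a b : H, LinearMap.mulRight k (a + b) =
          LinearMap.mulRight k a + LinearMap.mulRight k b from fun _ _ => by ext; simp [mul_add]]
        simp [TensorProduct.map_add_right])
      (fun _ _ _ => by
        rw [show ∀ (c : k) (a : H), LinearMap.mulRight k (c • a) =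
          c • LinearMap.mulRight k a from fun _ _ => by ext; simp]
        simp [TensorProduct.map_smul_right])))
    (fun _ _ _ => hom_ext fun _ _ => by simp [TensorProduct.map_add_left])
    (fun _ _ _ => hom_ext fun _ _ => by simp [TensorProduct.map_smul_left])
    (fun _ _ _ => hom_ext fun _ _ => by simp)
    (fun _ _ _ => hom_ext fun _ _ => by simp))

noncomputable instance : Mul (QuantumDouble k H) := ⟨fun a b => mulMap k H a b⟩

theorem tmul_mul_tmul (φ ψ : Module.Dual k H) (h g : H) :
    tmul φ h * tmul ψ g = ofTensor k H
      (TensorProduct.map ((dualMul k H).flip φ) (LinearMap.mulRight k g) (cross k H ψ h)) := rfl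

/-- The unit `ε ⊗ 1`. -/
noncomputable instance : One (QuantumDouble k H) := ⟨tmul counit 1⟩

/-- The antipode of `D(H)`, `S(φ ⊗ h) = (1 ⊗ S h)(φ ∘ S⁻¹ ⊗ 1)`, where `S⁻¹` is the inverse of the
antipode in the ring of linear endomorphisms of `H`. -/
noncomputable def antipode : QuantumDouble k H →ₗ[k] QuantumDouble k H :=
  lift (LinearMap.mk₂ k
    (fun φ h => mulMap k H (tmul counit (HopfAlgebra.antipode k h))
      (tmul (φ ∘ₗ Ring.inverse (HopfAlgebra.antipode k : Module.End k H)) 1))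
    (fun _ _ _ => by simp [tmul, LinearMap.add_comp, TensorProduct.add_tmul])
    (fun _ _ _ => by simp [tmul, LinearMap.smul_comp, ← TensorProduct.smul_tmul'])
    (fun _ _ _ => by simp [tmul, TensorProduct.tmul_add])
    (fun _ _ _ => by simp [tmul]))

theorem antipode_tmul (φ : Module.Dual k H) (h : H) :
    antipode k H (tmul φ h) = tmul counit (HopfAlgebra.antipode k h) *
      tmul (φ ∘ₗ Ring.inverse (HopfAlgebra.antipode k : Module.End k H)) 1 := rfl

section

variable [Module.Finite k H]

/-- The coproduct of `H^*`, characterised by `φ₁(h) φ₂(g) = φ(h g)`. -/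
noncomputable def dualComul : Module.Dual k H →ₗ[k] Module.Dual k H ⊗[k] Module.Dual k H :=
  (TensorProduct.dualDistribEquiv k H H).symm.toLinearMap ∘ₗ (LinearMap.mul' k H).dualMap

/-- The tensor product coalgebra `H^* ⊗ H`:
`Δ(φ ⊗ h) = (φ₁ ⊗ h₁) ⊗ (φ₂ ⊗ h₂)` and `ε(φ ⊗ h) = φ(1) ε(h)`. -/
noncomputable instance : CoalgebraStruct k (QuantumDouble k H) where
  comul := TensorProduct.map (ofTensor k H).toLinearMap (ofTensor k H).toLinearMap ∘ₗ
    (TensorProduct.tensorTensorTensorComm k (Module.Dual k H) (Module.Dual k H)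
      H H).toLinearMap ∘ₗ TensorProduct.map (dualComul k H) comul ∘ₗ
    (ofTensor k H).symm.toLinearMap
  counit := LinearMap.mul' k k ∘ₗ TensorProduct.map (Module.Dual.eval k H 1) counit ∘ₗ
    (ofTensor k H).symm.toLinearMap

end

section

variable [StarRing k] [StarRing H] [StarModule k H]

variable {k H} in
/-- The `*`-structure of `H^*`: `φ^*(h)` is the conjugate of `φ(S(h)^*)`. -/
noncomputable def dualStar (φ : Module.Dual k H) : Module.Dual k H where
  toFun h := star (φ (star (HopfAlgebra.antipode k h)))
  map_add' _ _ := by simp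
  map_smul' _ _ := by simp

/-- The `*`-operation of `D(H)` that restricts to those of `H` and `H^*`:
`(φ ⊗ h)^* = (1 ⊗ h^*)(φ^* ⊗ 1)`. -/
noncomputable def starMap : QuantumDouble k H →+ QuantumDouble k H :=
  (TensorProduct.liftAddHom
    (AddMonoidHom.mk' (fun φ => AddMonoidHom.mk'
      (fun h => mulMap k H (tmul counit (star h)) (tmul (dualStar φ) 1))
      (fun a b => by simp [tmul, TensorProduct.tmul_add]))
      (fun φ ψ => by
        ext h
        have : dualStar (φ + ψ) = dualStar φ + dualStar ψ := by ext; simp [dualStar]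
        simp [tmul, this, TensorProduct.add_tmul]))
    (fun c φ h => by
      have : dualStar (c • φ) = star c • dualStar φ := by ext; simp [dualStar]
      simp [tmul, this, ← TensorProduct.smul_tmul'])).comp
    (ofTensor k H).symm.toLinearMap.toAddMonoidHom

noncomputable instance : Star (QuantumDouble k H) := ⟨starMap k H⟩

theorem star_tmul (φ : Module.Dual k H) (h : H) :
    star (tmul φ h) = tmul counit (star h) * tmul (dualStar φ) 1 := rfl

end

end

end QuantumDouble

/-! Both Hopf algebras are combinatorial: each has a basis on which every structure map gives zero,
a basis vector or a multiplicity-free sum of basis vectors, except that the counits take the values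
0 and 1. The theorem thus reduces to a bijection of index sets (`indexEquiv`) carrying one
combinatorial structure to the other.

On the side of the double, the reordering of `(1 ⊗ h)(ψ ⊗ 1)` is a priori a double sum, but for
basis vectors exactly one term survives (`cross_coord`). Hence a product of two basis vectors is
zero or a basis vector (`tmul_coord_mul_tmul_coord`), and the antipode and the star permute the
basis (through `tmul_counit_mul_tmul_one`).

On the other side, `x ⊗ δ_y` is an arrow from `y` to `x y x⁻¹`, and products are compositions of
arrows. In the coordinates `x = (s ▹ u)⁻¹ t`, `y = v (t ◃ v)⁻¹ s⁻¹ t`, the identities `t v = (t ▹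
v)(t ◃ v)` and `s u = (s ▹ u)(s ◃ u)` give `x y x⁻¹ = (s ▹ u)⁻¹ (t ▹ v) u · (s ◃ u)⁻¹` and `x ◃ y =
u⁻¹ (t ◃ v)` (`dressL_index`, `dressR_index`). With these, each compatibility of `ψ` is a
computation in the group `X`. -/

namespace MatchedPair

/-! ### Identities in a matched pair. -/

variable {G M : Type*} [Group G] [Group M] (P : MatchedPair G M)

theorem lact_inv_eq (s : M) (u : G) : (P.lact s u)⁻¹ = P.lact (P.ract s u) u⁻¹ := by
  rw [inv_eq_iff_mul_eq_one, ← P.lact_mul, mul_inv_cancel, P.lact_one]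

theorem ract_inv_eq (s : M) (u : G) : (P.ract s u)⁻¹ = P.ract s⁻¹ (P.lact s u) := by
  rw [eq_comm]
  refine eq_inv_of_mul_eq_one_left ?_
  rw [← P.mul_ract, inv_mul_cancel, P.one_ract]

theorem lact_inv_lact_self (s : M) (u : G) : P.lact s⁻¹ (P.lact s u) = u := by
  rw [P.lact_lact, inv_mul_cancel, P.one_lact]

theorem lact_lact_inv_self (s : M) (u : G) : P.lact s (P.lact s⁻¹ u) = u := by
  rw [P.lact_lact, mul_inv_cancel, P.one_lact]

theorem ract_ract_inv (s : M) (u : G) : P.ract (P.ract s u) u⁻¹ = s := by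
  rw [P.ract_ract, mul_inv_cancel, P.ract_one]

theorem ract_inv_ract (s : M) (u : G) : P.ract (P.ract s u⁻¹) u = s := by
  rw [P.ract_ract, inv_mul_cancel, P.ract_one]

theorem lact_eq_one_iff (s : M) (u : G) : P.lact s u = 1 ↔ u = 1 :=
  ⟨fun h => by rw [← P.lact_inv_lact_self s u, h, P.lact_one], fun h => by rw [h, P.lact_one]⟩

theorem inv_lact_eq_lact_ract_iff (t : M) (x w : G) :
    (P.lact t x)⁻¹ = P.lact (P.ract t x) w ↔ x = w⁻¹ := by
  rw [inv_eq_iff_mul_eq_one, ← P.lact_mul, P.lact_eq_one_iff, mul_eq_one_iff_eq_inv]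

/-- The two arguments are the labels of the functional produced by `cross_coord`. This value decides
whether the product of that functional with another dual basis vector vanishes. -/
theorem ract_cross (m s : M) (g u : G) :
    P.ract (P.ract m (P.lact s u)⁻¹ * s * (P.ract m (g * u⁻¹))⁻¹)
      (P.lact (P.ract m (g * u⁻¹)) u) = m * P.ract s u * (P.ract m g)⁻¹ := by
  rw [P.mul_ract, ← P.ract_inv_eq, P.lact_inv_lact_self, P.mul_ract, P.ract_inv_ract,
    P.ract_ract, inv_mul_cancel_right]

/-- Companion of `ract_cross` for the same labels: it gives the `G`-part, up to inversion, of the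
element of `X` attached to a reordered product. -/
theorem lact_cross (m s : M) (g u : G) :
    P.lact (P.ract m (P.lact s u)⁻¹ * s * (P.ract m (g * u⁻¹))⁻¹)
      (P.lact (P.ract m (g * u⁻¹)) u) = (P.lact m (P.lact s u)⁻¹)⁻¹ := by
  rw [P.lact_lact, inv_mul_cancel_right, ← P.lact_lact, P.lact_inv_eq m, inv_inv]

end MatchedPair

/-! ### The dual basis, the counit and the antipode of a bicrossproduct. -/

namespace Bicross

variable {k : Type*} [Field k] {G M : Type*} [Group G] [Group M] (P : MatchedPair G M)

open Classical in
theorem coord_of (p : M × G) (a : M) (b : G) :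
    (basis P).coord p (of P a b : Bicross k P) = if a = p.1 ∧ b = p.2 then 1 else 0 := by
  rw [of, Module.Basis.coord_apply, Module.Basis.repr_self, Finsupp.single_apply]
  simp [Prod.ext_iff]

variable {P} in
theorem dual_ext {f g : Module.Dual k (Bicross k P)} (e : ∀ s u, f (of P s u) = g (of P s u)) :
    f = g :=
  (basis P).ext fun p => e p.1 p.2

variable [Finite G]

theorem counit_eq_sum [Fintype M] :
    (Coalgebra.counit : Bicross k P →ₗ[k] k) = ∑ s : M, (basis P).coord (s, 1) := by
  classical
  refine dual_ext fun s u => ?_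
  rw [counit_of, LinearMap.sum_apply]
  simp only [coord_of]
  by_cases h : u = 1 <;> simp [h]

theorem antipode_antipode (a : Bicross k P) :
    HopfAlgebra.antipode k (HopfAlgebra.antipode k a) = a := by
  have : (HopfAlgebra.antipode k : Bicross k P →ₗ[k] _) ∘ₗ HopfAlgebra.antipode k = .id := by
    refine (basis P).ext fun p => ?_
    simp only [basis_apply, LinearMap.comp_apply, antipode_of, LinearMap.id_apply, lact_inv_lact,
      ract_inv_lact, inv_inv]
  exact congr($this a)

/-- Since the antipode is an involution it is a unit in the endomorphism ring, so `Ring.inverse` is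
its true inverse and not the default value 0. -/
theorem inverse_antipode :
    Ring.inverse (HopfAlgebra.antipode k : Module.End k (Bicross k P)) =
      HopfAlgebra.antipode k := by
  have h : (HopfAlgebra.antipode k : Module.End k (Bicross k P)) * HopfAlgebra.antipode k = 1 :=
    LinearMap.ext (antipode_antipode P)
  exact Ring.inverse_unit ⟨_, _, h, h⟩

theorem coord_comp_antipode (s : M) (u : G) :
    (basis P).coord (s, u) ∘ₗ (HopfAlgebra.antipode k : Bicross k P →ₗ[k] _) =
      (basis P).coord ((P.ract s u)⁻¹, (P.lact s u)⁻¹) := by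
  classical
  refine dual_ext fun a b => ?_
  rw [LinearMap.comp_apply, antipode_of, coord_of, coord_of]
  congr 1
  refine propext ⟨?_, ?_⟩
  · rintro ⟨rfl, rfl⟩
    simp [lact_inv_lact, ract_inv_lact]
  · rintro ⟨rfl, rfl⟩
    simp [lact_inv_lact, ract_inv_lact]

end Bicross

/-! ### The dual Hopf algebra and the reordering rule on basis vectors. -/

namespace QuantumDouble

open Bicross

variable {k : Type*} [Field k] {G M : Type*} [Group G] [Group M] (P : MatchedPair G M)

/-- The basis `(δ_s ⊗ u) ⊗ (t ⊗ δ_v)` of the double of a bicrossproduct, for finite groups. -/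
noncomputable def basis [Finite G] [Finite M] :
    Module.Basis ((M × G) × (M × G)) k (QuantumDouble k (Bicross k P)) :=
  open Classical in
  ((Bicross.basis P).dualBasis.tensorProduct (Bicross.basis P)).map (ofTensor k _)

theorem basis_apply [Finite G] [Finite M] (p : (M × G) × (M × G)) :
    basis P p = (tmul ((Bicross.basis P).coord p.1) (of P p.2.1 p.2.2) :
      QuantumDouble k (Bicross k P)) := by
  classical
  rw [basis, Module.Basis.map_apply, Module.Basis.tensorProduct_apply', Module.Basis.coe_dualBasis]
  rfl

variable [Finite G]

open Classical in
theorem dualMul_coord (a b : M) (p q : G) :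
    dualMul k (Bicross k P) ((Bicross.basis P).coord (a, p)) ((Bicross.basis P).coord (b, q)) =
      if b = P.ract a p then (Bicross.basis P).coord (a, p * q) else 0 := by
  have := Fintype.ofFinite G
  refine dual_ext fun m g => ?_
  simp only [dualMul, LinearMap.mk₂_apply, LinearMap.comp_apply, comul_of, map_sum,
    TensorProduct.map_tmul, LinearMap.mul'_apply, coord_of]
  rw [Finset.sum_eq_single p]
  · simp only [inv_mul_eq_iff_eq_mul, eq_comm (a := b)]
    by_cases hm : m = a
    · subst hm
      by_cases hb : P.ract m p = b <;> simp [hb, -Module.Basis.coord_apply, coord_of]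
    · split_ifs <;> simp_all [-Module.Basis.coord_apply, coord_of]
  · intro x _ hx; simp [hx]
  · simp

-- The two products inside `ψ(S(a) x b)` fix all labels of `x`. Matching the `M`-label forces `m t'
-- = (t ◃ x) s`; the remaining composability condition then becomes `(t ▹ x)⁻¹ = (t ◃ x) ▹ (s ▹ u)`,
-- that is, `x = (s ▹ u)⁻¹`, whatever `t` is.
open Classical in
theorem sandwich_coord (s t t' : M) (u x z : G) :
    sandwich ((Bicross.basis P).coord (s, u)) (of P t x) (of P t' z : Bicross k P) =
      if z = u ∧ x = (P.lact s u)⁻¹ then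
        (Bicross.basis P).coord (P.ract t x * s * t'⁻¹, P.lact t' u) else 0 := by
  refine dual_ext fun m g => ?_
  simp only [sandwich, LinearMap.mk₂_apply, LinearMap.comp_apply, LinearMap.mulRight_apply,
    LinearMap.mulLeft_apply, antipode_of, of_mul_of]
  have hS : (P.ract t x)⁻¹ * (m * t') = s ↔ m = P.ract t x * s * t'⁻¹ := by
    rw [inv_mul_eq_iff_eq_mul, ← eq_mul_inv_iff_mul_eq]
  by_cases hg : g = P.lact t' z
  · rw [if_pos hg, of_mul_of]
    by_cases hs : m = P.ract t x * s * t'⁻¹ ∧ z = u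
    · obtain ⟨hm, rfl⟩ := hs
      have hx : (P.lact t x)⁻¹ = P.lact (m * t') z ↔ x = (P.lact s z)⁻¹ := by
        rw [← P.inv_lact_eq_lact_ract_iff t, P.lact_lact, ← hS.2 hm, mul_inv_cancel_left]
      simp only [hx, true_and]
      split_ifs
      · rw [coord_of, coord_of, if_pos ⟨hS.2 hm, rfl⟩, if_pos ⟨hm, hg⟩]
      · simp
    · trans (0 : k)
      · split_ifs
        · rw [coord_of, if_neg (by rwa [hS])]
        · simp
      · split_ifs with h
        · rw [coord_of, if_neg fun h' => hs ⟨h'.1, h.1⟩]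
        · simp
  · rw [if_neg hg, mul_zero, map_zero]
    split_ifs with h
    · rw [coord_of, if_neg fun h' => hg (by rw [h'.2, h.1])]
    · simp

-- In the iterated coproduct of `t ⊗ δ_v` the `G`-labels run over `x y z = v`. By `sandwich_coord`
-- only `x = (s ▹ u)⁻¹` and `z = u` contribute, which leaves the single middle label `y = (s ▹ u) v
-- u⁻¹`.
open Classical in
theorem cross_coord (s t : M) (u v : G) :
    cross k (Bicross k P) ((Bicross.basis P).coord (s, u)) (of P t v) =
      (Bicross.basis P).coord
        (P.ract t (P.lact s u)⁻¹ * s * (P.ract t (v * u⁻¹))⁻¹, P.lact (P.ract t (v * u⁻¹)) u) ⊗ₜ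
      of P (P.ract t (P.lact s u)⁻¹) (P.lact s u * v * u⁻¹) := by
  have := Fintype.ofFinite G
  simp only [cross, LinearMap.coe_mk, AddHom.coe_mk, LinearMap.comp_apply, comul_of, map_sum,
    LinearMap.lTensor_tmul, LinearEquiv.coe_coe, TensorProduct.tmul_sum, TensorProduct.comm_tmul,
    TensorProduct.assoc_symm_tmul, LinearMap.rTensor_tmul, TensorProduct.lift.tmul,
    sandwich_coord]
  rw [Finset.sum_eq_single (P.lact s u)⁻¹, Finset.sum_eq_single (P.lact s u * v * u⁻¹)]
  · rw [if_pos (by constructor <;> group), P.ract_ract]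
    simp [mul_assoc]
  · intro y _ hy
    rw [if_neg, TensorProduct.zero_tmul]
    rintro ⟨h, -⟩
    rw [inv_mul_eq_iff_eq_mul, inv_inv] at h
    exact hy (by rw [h, mul_inv_cancel_right])
  · simp
  · intro x _ hx
    exact Finset.sum_eq_zero fun y _ => by rw [if_neg fun h => hx h.2, TensorProduct.zero_tmul]
  · simp

-- `dualDistribEquiv` identifies `H^* ⊗ H^*` with `(H ⊗ H)^*`, so it suffices to evaluate both sides
-- on products of basis vectors; the summand that survives is the one whose `b` is the `M`-label of
-- the second factor.
open Classical in
theorem dualComul_coord [Fintype M] (s : M) (u : G) :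
    dualComul k (Bicross k P) ((Bicross.basis P).coord (s, u)) =
      ∑ b : M, (Bicross.basis P).coord (s * b⁻¹, P.lact b u) ⊗ₜ (Bicross.basis P).coord (b, u) := by
  rw [dualComul, LinearMap.comp_apply, LinearEquiv.coe_coe, LinearEquiv.symm_apply_eq]
  refine ((Bicross.basis (k := k) P).tensorProduct (Bicross.basis P)).ext fun p => ?_
  rw [Module.Basis.tensorProduct_apply', map_sum, LinearMap.sum_apply]
  change (Bicross.basis P).coord (s, u) ((of P p.1.1 p.1.2 : Bicross k P) * of P p.2.1 p.2.2) =
    ∑ b : M, (Bicross.basis P).coord (s * b⁻¹, P.lact b u) (of P p.1.1 p.1.2) * 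
      (Bicross.basis P).coord (b, u) (of P p.2.1 p.2.2)
  rw [of_mul_of]
  simp only [coord_of]
  rw [Finset.sum_eq_single p.2.1]
  · simp only [eq_mul_inv_iff_mul_eq, true_and]
    by_cases h1 : p.2.2 = u
    · rw [h1]
      split_ifs <;> simp_all [-Module.Basis.coord_apply, coord_of]
    · split_ifs <;> simp_all [-Module.Basis.coord_apply, coord_of]
  · intro b _ hb; simp [hb.symm]
  · simp

end QuantumDouble

/-! ### Structure maps of the double on its basis. -/

namespace QuantumDouble

open Bicross

variable {k : Type*} [Field k] {G M : Type*} [Group G] [Group M] (P : MatchedPair G M) [Finite G]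

open Classical in
theorem tmul_coord_mul_tmul_coord (a m s t : M) (p g u v : G) :
    (tmul ((Bicross.basis P).coord (a, p)) (of P m g) : QuantumDouble k (Bicross k P)) *
        tmul ((Bicross.basis P).coord (s, u)) (of P t v) =
      if a = m * P.ract s u * (P.ract m g)⁻¹ ∧ P.lact s u * g * u⁻¹ = P.lact t v then
        tmul ((Bicross.basis P).coord
            (P.ract m (P.lact s u)⁻¹ * s * (P.ract m (g * u⁻¹))⁻¹,
              P.lact (P.ract m (g * u⁻¹)) u * p))
          (of P (P.ract m (P.lact s u)⁻¹ * t) v)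
      else 0 := by
  rw [tmul_mul_tmul, cross_coord, TensorProduct.map_tmul, LinearMap.flip_apply, dualMul_coord,
    P.ract_cross,
    LinearMap.mulRight_apply, of_mul_of, ite_and]
  split_ifs <;> simp [tmul, -Module.Basis.coord_apply]

/-- Antipode and star of the double are both defined by products of this shape. The outer factors
`ε` and `1` are units, so only the single term of `cross_coord` remains. -/
theorem tmul_counit_mul_tmul_one [Finite M] (s t : M) (u v : G) :
    (tmul Coalgebra.counit (of P t v) : QuantumDouble k (Bicross k P)) *
        tmul ((Bicross.basis P).coord (s, u)) 1 =
      tmul ((Bicross.basis P).coord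
          (P.ract t (P.lact s u)⁻¹ * s * (P.ract t (v * u⁻¹))⁻¹, P.lact (P.ract t (v * u⁻¹)) u))
        (of P (P.ract t (P.lact s u)⁻¹) (P.lact s u * v * u⁻¹)) := by
  classical
  have := Fintype.ofFinite G
  have := Fintype.ofFinite M
  rw [tmul_mul_tmul, cross_coord, TensorProduct.map_tmul, LinearMap.mulRight_apply, mul_one,
    LinearMap.flip_apply, counit_eq_sum, map_sum]
  simp only [dualMul_coord]
  simp [tmul, -Module.Basis.coord_apply]

theorem one_eq_sum [Fintype G] [Fintype M] :
    (1 : QuantumDouble k (Bicross k P)) =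
      ∑ s : M, ∑ v : G, tmul ((Bicross.basis P).coord (s, 1)) (of P 1 v) := by
  change ofTensor k _ (Coalgebra.counit ⊗ₜ[k] 1) = _
  rw [counit_eq_sum, Bicross.one_def, TensorProduct.sum_tmul, map_sum]
  simp only [TensorProduct.tmul_sum, map_sum]
  rfl

theorem comul_tmul_coord [Fintype G] [Fintype M] (s t : M) (u v : G) :
    Coalgebra.comul (R := k)
        (tmul ((Bicross.basis P).coord (s, u)) (of P t v) : QuantumDouble k (Bicross k P)) =
      ∑ b : M, ∑ x : G,
        tmul ((Bicross.basis P).coord (s * b⁻¹, P.lact b u)) (of P t x) ⊗ₜ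
          tmul ((Bicross.basis P).coord (b, u)) (of P (P.ract t x) (x⁻¹ * v)) := by
  change TensorProduct.map (ofTensor k _).toLinearMap (ofTensor k _).toLinearMap
    (TensorProduct.tensorTensorTensorComm k _ _ _ _
      (dualComul k (Bicross k P) ((Bicross.basis P).coord (s, u)) ⊗ₜ
        Coalgebra.comul (of P t v : Bicross k P))) = _
  rw [dualComul_coord, comul_of]
  simp only [TensorProduct.sum_tmul, TensorProduct.tmul_sum, map_sum]
  rw [Finset.sum_comm]
  rfl

open Classical in
theorem counit_tmul_coord [Finite M] (s t : M) (u v : G) :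
    Coalgebra.counit (R := k)
        (tmul ((Bicross.basis P).coord (s, u)) (of P t v) : QuantumDouble k (Bicross k P)) =
      if s = 1 ∧ v = 1 then 1 else 0 := by
  have := Fintype.ofFinite G
  change (Bicross.basis P).coord (s, u) (1 : Bicross k P) * Coalgebra.counit (of P t v : Bicross k P) = _
  rw [counit_of, Bicross.one_def, map_sum]
  simp only [coord_of]
  by_cases hs : s = 1 <;> simp [hs, eq_comm]

theorem dualStar_coord [StarRing k] (s : M) (u : G) :
    dualStar ((Bicross.basis P).coord (s, u) : Module.Dual k (Bicross k P)) =
      (Bicross.basis P).coord (P.ract s u, u⁻¹) := by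
  classical
  refine dual_ext fun a b => ?_
  change star ((Bicross.basis (k := k) P).coord (s, u)
    (star (HopfAlgebra.antipode k (of P a b : Bicross k P)))) = _
  rw [antipode_of, star_of, inv_inv, lact_inv_lact, coord_of, coord_of]
  have : (P.ract a b = s ∧ b⁻¹ = u) ↔ (a = P.ract s u ∧ b = u⁻¹) := by
    constructor
    · rintro ⟨rfl, rfl⟩
      simp [P.ract_ract_inv]
    · rintro ⟨rfl, rfl⟩
      simp [P.ract_ract_inv]
  simp only [this]
  split_ifs <;> simp

/-- `starMap` is built as an additive map only; conjugate-linearity is needed to reduce the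
compatibility with the star to basis vectors. -/
theorem star_smul {H : Type*} [Ring H] [HopfAlgebra k H] [StarRing k] [StarRing H] [StarModule k H]
    (c : k) (a : QuantumDouble k H) : star (c • a) = star c • star a := by
  induction a using TensorProduct.induction_on with
  | zero =>
    have h0 : star (0 : QuantumDouble k H) = 0 := map_zero (starMap k H)
    change star (c • (0 : QuantumDouble k H)) = star c • star (0 : QuantumDouble k H)
    rw [smul_zero, h0, smul_zero]
  | tmul φ h =>
    have hφ : dualStar (c • φ) = star c • dualStar φ := by ext; simp [dualStar]
    change star (tmul (c • φ) h) = star c • star (tmul φ h)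
    rw [star_tmul, star_tmul, hφ]
    change mulMap k H _ (star c • tmul (dualStar φ) 1) = _
    rw [map_smul]
    rfl
  | add a b ha hb =>
    have hadd (a b : QuantumDouble k H) : star (c • a) = star c • star a →
        star (c • b) = star c • star b → star (c • (a + b)) = star c • star (a + b) := by
      intro ha hb
      have h (a b : QuantumDouble k H) : star (a + b) = star a + star b :=
        map_add (starMap k H) a b
      rw [smul_add, h, h, smul_add, ha, hb]
    exact hadd a b ha hb

end QuantumDouble

/-! ### The bijection of index sets and the actions in the new coordinates. -/

namespace GroupFactorisation

variable {X : Type*} [Group X] {G M : Subgroup X} (h : G.IsComplement' M)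

/-- The element `(s ▹ u)⁻¹ t` of `X`. -/
noncomputable def indexX (s t : M) (u : G) : X :=
  (((matchedPair h).lact s u : G) : X)⁻¹ * (t : X)

/-- The element `(v, (t ◃ v)⁻¹ s⁻¹ t)` of `Y = G × Mᵐᵒᵖ`. -/
noncomputable def indexY (s t : M) (v : G) : G × Mᵐᵒᵖ :=
  (v, MulOpposite.op (((matchedPair h).ract t v)⁻¹ * s⁻¹ * t))

theorem indexX_fact (s t : M) (u : G) :
    factG h (indexX h s t u) = ((matchedPair h).lact s u)⁻¹ ∧ factM h (indexX h s t u) = t :=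
  fact_eq h (by simp [indexX])

/-- The bijection between the bases of `D(H)` and of `kX ▷◀ k(Y)`. -/
noncomputable def indexEquiv : (M × G) × (M × G) ≃ X × (G × Mᵐᵒᵖ) where
  toFun p := (indexX h p.1.1 p.2.1 p.1.2, indexY h p.1.1 p.2.1 p.2.2)
  invFun q :=
    -- The `M`-part of `x` is `t`; then `r = (t ◃ v)⁻¹ s⁻¹ t` is solved for `s`, and the `G`-part
    -- `(s ▹ u)⁻¹` of `x` for `u`.
    let t := factM h q.1
    let s := t * (q.2.2.unop)⁻¹ * ((matchedPair h).ract t q.2.1)⁻¹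
    ((s, (matchedPair h).lact s⁻¹ (factG h q.1)⁻¹), (t, q.2.1))
  left_inv p := by
    obtain ⟨⟨s, u⟩, t, v⟩ := p
    have hs : t * (((matchedPair h).ract t v)⁻¹ * s⁻¹ * t)⁻¹ * ((matchedPair h).ract t v)⁻¹ = s := by
      group
    simp only [indexX_fact, indexY, MulOpposite.unop_op, hs, inv_inv,
      MatchedPair.lact_inv_lact_self]
  right_inv q := by
    obtain ⟨x, v, r⟩ := q
    refine Prod.ext ?_ (Prod.ext rfl ?_)
    · dsimp only
      rw [indexX, MatchedPair.lact_lact_inv_self, InvMemClass.coe_inv, inv_inv, factG_mul_factM]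
    · refine MulOpposite.unop_injective ?_
      simp only [indexY, MulOpposite.unop_op]
      group

theorem coe_lact (s : M) (u : G) :
    (((matchedPair h).lact s u : G) : X) = s * u * (((matchedPair h).ract s u : M) : X)⁻¹ :=
  eq_mul_inv_of_mul_eq (lact_mul_ract h s u)

/-- In the conjugate, `t v (t ◃ v)⁻¹` collapses to `t ▹ v` and `s⁻¹ (s ▹ u)` to `u (s ◃ u)⁻¹`, which
leaves an element already factorised along `GM`. -/
theorem dressL_index (s t : M) (u v : G) :
    dressL h (indexX h s t u) (indexY h s t v) =
      (((matchedPair h).lact s u)⁻¹ * (matchedPair h).lact t v * u,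
        MulOpposite.op ((matchedPair h).ract s u)⁻¹) := by
  apply toX_injective h
  rw [toX_dressL]
  simp only [toX, indexX, indexY, MulOpposite.unop_op, Subgroup.coe_mul, InvMemClass.coe_inv,
    coe_lact]
  group

theorem dressR_index (s t : M) (u v : G) :
    dressR h (indexX h s t u) (indexY h s t v) =
      (u : X)⁻¹ * (((matchedPair h).ract t v : M) : X) := by
  rw [dressR_eq, dressL_index]
  simp only [indexX, indexY, Subgroup.coe_mul, InvMemClass.coe_inv, coe_lact]
  group

/-- Two basis elements have a nonzero product in `kX ▷◀ k(Y)` exactly when the corresponding ones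
do in the double. -/
theorem index_composable_iff (a m s t : M) (g u v : G) :
    indexY h a m g = (dressingPair h).lact (indexX h s t u) (indexY h s t v) ↔
      a = m * (matchedPair h).ract s u * ((matchedPair h).ract m g)⁻¹ ∧
        (matchedPair h).lact s u * g * u⁻¹ = (matchedPair h).lact t v := by
  change _ = dressL h _ _ ↔ _
  rw [dressL_index, indexY, Prod.ext_iff, and_comm]
  simp only [MulOpposite.op_inj]
  refine and_congr ?_ ?_
  · rw [← inv_inj, eq_comm]
    simp only [mul_inv_rev, inv_inv]
    rw [eq_comm, mul_assoc, inv_mul_eq_iff_eq_mul, ← mul_assoc, eq_mul_inv_iff_mul_eq]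
  · rw [mul_assoc, eq_inv_mul_iff_mul_eq, mul_inv_eq_iff_eq_mul]

end GroupFactorisation

open GroupFactorisation

/-! ### The linear isomorphism and its compatibility with each structure map. -/

namespace QuantumDouble

variable {k X : Type*} [Field k] [Group X] [Finite X] {G M : Subgroup X} (h : G.IsComplement' M)

/-- The isomorphism `D(kM ▷◀ k(G)) ≃ kX ▷◀ k(Y)` of vector spaces. -/
noncomputable def toBicross :
    QuantumDouble k (Bicross k (matchedPair h)) ≃ₗ[k] Bicross k (dressingPair h) :=
  (basis (matchedPair h)).equiv (Bicross.basis (dressingPair h)) (indexEquiv h)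

theorem toBicross_tmul (s t : M) (u v : G) :
    toBicross (k := k) h (tmul ((Bicross.basis (matchedPair h)).coord (s, u))
      (Bicross.of (matchedPair h) t v)) =
      Bicross.of (dressingPair h) (indexX h s t u) (indexY h s t v) := by
  have := (basis (k := k) (matchedPair h)).equiv_apply ((s, u), (t, v))
    (Bicross.basis (dressingPair h)) (indexEquiv h)
  rwa [basis_apply] at this

theorem toBicross_one : toBicross (k := k) h 1 = 1 := by
  have := Fintype.ofFinite G
  have := Fintype.ofFinite M
  have := Fintype.ofFinite (G × Mᵐᵒᵖ)
  rw [one_eq_sum, Bicross.one_def]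
  simp only [map_sum, toBicross_tmul]
  rw [Finset.sum_comm, ← Fintype.sum_prod_type']
  -- With trivial `u` and `t`, the pair `(v, s)` is sent to `e ⊗ δ_{(v, s⁻¹)}`, so inversion on `M`
  -- matches the two sums.
  refine Fintype.sum_equiv ((Equiv.refl G).prodCongr ((Equiv.inv M).trans MulOpposite.opEquiv))
    _ _ fun p => ?_
  simp [indexX, indexY, MatchedPair.lact_one, MatchedPair.one_ract, Prod.map]

theorem toBicross_mul (a b : QuantumDouble k (Bicross k (matchedPair h))) :
    toBicross h (a * b) = toBicross h a * toBicross h b := by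
  classical
  have key : (mulMap k (Bicross k (matchedPair h))).compr₂ (toBicross h).toLinearMap =
      (Bicross.mulMap (dressingPair h)).compl₁₂ (toBicross h).toLinearMap
        (toBicross h).toLinearMap := by
    refine (basis _).ext fun p => (basis _).ext fun q => ?_
    obtain ⟨⟨a, p⟩, m, g⟩ := p
    obtain ⟨⟨s, u⟩, t, v⟩ := q
    rw [basis_apply, basis_apply]
    change toBicross h (_ * _) = toBicross h _ * toBicross h _
    rw [tmul_coord_mul_tmul_coord, toBicross_tmul, toBicross_tmul, Bicross.of_mul_of]
    simp only [index_composable_iff]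
    split_ifs with hc
    · obtain ⟨rfl, hy⟩ := hc
      rw [toBicross_tmul]
      -- Composability, rewritten so that `((m ◃ (s ▹ u)⁻¹) t) ◃ v` becomes `(m ◃ g u⁻¹)(t ◃ v)` and
      -- the factors `m ◃ g u⁻¹` cancel in the label from `Y`.
      have hg : g * u⁻¹ = ((matchedPair h).lact s u)⁻¹ * (matchedPair h).lact t v := by
        rw [← hy]; group
      congr 1
      -- The label reduces to `(a ▹ p)⁻¹ (m ▹ w)(m ◃ w) t` with `w = (s ▹ u)⁻¹`; the middle factors
      -- recombine to `m w`.
      · rw [indexX, (matchedPair h).lact_mul, (matchedPair h).lact_cross, (matchedPair h).ract_cross]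
        have := lact_mul_ract h m ((matchedPair h).lact s u)⁻¹
        simp only [indexX, Subgroup.coe_mul, InvMemClass.coe_inv, mul_inv_rev, inv_inv] at this ⊢
        rw [mul_assoc, ← mul_assoc ((matchedPair h).lact m _ : X), this]
        group
      · rw [indexY, (matchedPair h).mul_ract, (matchedPair h).ract_ract, hg]
        refine Prod.ext rfl (MulOpposite.unop_injective ?_)
        simp only [indexY, MulOpposite.unop_op]
        group
    · simp
  exact congr($key a b)

theorem map_comul_toBicross (a : QuantumDouble k (Bicross k (matchedPair h))) :
    TensorProduct.map (toBicross h).toLinearMap (toBicross h).toLinearMap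
      (Coalgebra.comul (R := k) a) = Coalgebra.comul (R := k) (toBicross h a) := by
  have := Fintype.ofFinite G
  have := Fintype.ofFinite M
  have := Fintype.ofFinite (G × Mᵐᵒᵖ)
  have key : TensorProduct.map (toBicross (k := k) h).toLinearMap (toBicross h).toLinearMap ∘ₗ
      Coalgebra.comul = Coalgebra.comul ∘ₗ (toBicross h).toLinearMap := by
    refine (basis _).ext fun p => ?_
    obtain ⟨⟨s, u⟩, t, v⟩ := p
    rw [basis_apply]
    change TensorProduct.map _ _ (Coalgebra.comul _) = Coalgebra.comul (toBicross h _)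
    rw [comul_tmul_coord, toBicross_tmul, Bicross.comul_of, Finset.sum_comm,
      ← Fintype.sum_prod_type', map_sum]
    -- For fixed `x`, the first tensor factor has `M`-label `(t ◃ x)⁻¹ b s⁻¹ t` in `Y`. As `b` runs
    -- over `M` so does this label, so the pairs `(x, b)` enumerate `Y`.
    let e (x : G) : M ≃ Mᵐᵒᵖ :=
      ((Equiv.mulLeft ((matchedPair h).ract t x)⁻¹).trans (Equiv.mulRight (s⁻¹ * t))).trans
        MulOpposite.opEquiv
    refine Fintype.sum_equiv (Equiv.prodShear (Equiv.refl G) e) _ _ fun p => ?_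
    obtain ⟨x, b⟩ := p
    -- The label from `X` in the first factor does not depend on `b`, because `s b⁻¹ ▹ (b ▹ u) = s ▹
    -- u`.
    have hx : indexX h (s * b⁻¹) t ((matchedPair h).lact b u) = indexX h s t u := by
      rw [indexX, MatchedPair.lact_lact, inv_mul_cancel_right, indexX]
    have hy : (Equiv.prodShear (Equiv.refl G) e) (x, b) = indexY h (s * b⁻¹) t x := by
      simp [e, indexY, mul_assoc]
    rw [hy, TensorProduct.map_tmul, LinearEquiv.coe_coe, toBicross_tmul, toBicross_tmul, hx]
    refine congrArg (_ ⊗ₜ ·) (congrArg₂ _ ?_ ?_)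
    · change _ = dressR h _ _
      rw [← hx, dressR_index]
      rfl
    · rw [eq_inv_mul_iff_mul_eq]
      refine Prod.ext (mul_inv_cancel_left x v) (MulOpposite.unop_injective ?_)
      simp only [indexY, Prod.mk_mul_mk, MulOpposite.unop_mul, MulOpposite.unop_op,
        MatchedPair.ract_ract, mul_inv_cancel_left]
      group
  exact congr($key a)

theorem counit_toBicross (a : QuantumDouble k (Bicross k (matchedPair h))) :
    Coalgebra.counit (R := k) (toBicross h a) = Coalgebra.counit (R := k) a := by
  classical
  have key : Coalgebra.counit ∘ₗ (toBicross (k := k) h).toLinearMap = Coalgebra.counit := by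
    refine (basis _).ext fun p => ?_
    obtain ⟨⟨s, u⟩, t, v⟩ := p
    rw [basis_apply]
    change Coalgebra.counit (toBicross (k := k) h _) = _
    rw [toBicross_tmul, counit_tmul_coord, Bicross.counit_of]
    congr 1
    rw [indexY, Prod.ext_iff, and_comm, eq_iff_iff]
    refine and_congr_left fun hv => ?_
    change v = 1 at hv
    rw [hv, MatchedPair.ract_one]
    simp [mul_assoc, inv_mul_eq_one, ← MulOpposite.unop_inj]
  exact congr($key a)

/-- Common input to `toBicross_antipode` and `toBicross_star`: after the change of labels the
reordered product takes a simple form, to be compared with `dressL_index` and `dressR_index`. -/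
theorem toBicross_counit_mul_one (s t : M) (u v : G) :
    toBicross (k := k) h (tmul Coalgebra.counit (Bicross.of (matchedPair h) t v) *
        tmul ((Bicross.basis (matchedPair h)).coord (s, u)) 1) =
      Bicross.of (dressingPair h) ((t : X) * (((matchedPair h).lact s u : G) : X)⁻¹)
        ((matchedPair h).lact s u * v * u⁻¹, MulOpposite.op s⁻¹) := by
  rw [tmul_counit_mul_tmul_one, toBicross_tmul]
  congr 1
  · rw [indexX, MatchedPair.lact_cross]
    simpa using lact_mul_ract h t ((matchedPair h).lact s u)⁻¹
  · refine Prod.ext rfl (MulOpposite.unop_injective ?_)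
    simp only [indexY, MulOpposite.unop_op, MatchedPair.ract_ract]
    rw [mul_assoc _ v, inv_mul_cancel_left]
    group

theorem toBicross_antipode (a : QuantumDouble k (Bicross k (matchedPair h))) :
    toBicross h (antipode k _ a) = HopfAlgebra.antipode k (toBicross h a) := by
  have key : (toBicross (k := k) h).toLinearMap ∘ₗ antipode k _ =
      HopfAlgebra.antipode k ∘ₗ (toBicross h).toLinearMap := by
    refine (basis _).ext fun p => ?_
    obtain ⟨⟨s, u⟩, t, v⟩ := p
    rw [basis_apply]
    change toBicross h (antipode k _ _) = HopfAlgebra.antipode k (toBicross h _)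
    rw [antipode_tmul, Bicross.antipode_of, Bicross.inverse_antipode, Bicross.coord_comp_antipode,
      toBicross_counit_mul_one, toBicross_tmul, Bicross.antipode_of, Bicross.lact_inv_lact]
    change _ = Bicross.of _ (dressR h _ _)⁻¹ (dressL h _ _)⁻¹
    rw [dressR_index, dressL_index]
    congr 1
    · simp
    · refine Prod.ext ?_ (MulOpposite.unop_injective ?_)
      · simp [mul_assoc]
      · simp
  exact congr($key a)

theorem toBicross_star [StarRing k] (a : QuantumDouble k (Bicross k (matchedPair h))) :
    toBicross h (star a) = star (toBicross h a) := by
  have hadd (a b : QuantumDouble k (Bicross k (matchedPair h))) : star (a + b) = star a + star b :=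
    map_add (starMap k _) a b
  have hzero : star (0 : QuantumDouble k (Bicross k (matchedPair h))) = 0 :=
    map_zero (starMap k _)
  induction (basis (matchedPair h)).mem_span a using Submodule.span_induction with
  | mem x hx =>
    obtain ⟨⟨⟨s, u⟩, t, v⟩, rfl⟩ := hx
    rw [basis_apply, star_tmul, Bicross.star_of, dualStar_coord, toBicross_counit_mul_one,
      toBicross_tmul, Bicross.star_of, ← MatchedPair.lact_inv_eq]
    change _ = Bicross.of _ _ (dressL h _ _)
    rw [dressL_index]
    congr 1
    · simp [indexX]
    · simp
  | zero => rw [hzero, map_zero, star_zero]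
  | add x y _ _ hx hy => rw [hadd, map_add, hx, hy, map_add, star_add]
  | smul c x _ hx => rw [star_smul, map_smul, hx, map_smul, Bicross.star_smul']

end QuantumDouble

theorem theorem2p2 {k X : Type*} [Field k] [Group X] [Finite X] (G M : Subgroup X)
    (hX : G.IsComplement' M) :
    ∃ ψ : QuantumDouble k (Bicross k (GroupFactorisation.matchedPair hX)) ≃ₗc[k]
        Bicross k (GroupFactorisation.dressingPair hX),
      (∀ (s t : M) (u v : G),
        ψ (QuantumDouble.tmul ((Bicross.basis (GroupFactorisation.matchedPair hX)).coord (s, u))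
            (Bicross.of (GroupFactorisation.matchedPair hX) t v)) =
          Bicross.of (GroupFactorisation.dressingPair hX)
            ((((GroupFactorisation.matchedPair hX).lact s u : G) : X)⁻¹ * (t : X))
            (v, MulOpposite.op (((GroupFactorisation.matchedPair hX).ract t v)⁻¹ * s⁻¹ * t))) ∧
      ψ 1 = 1 ∧
      (∀ a b, ψ (a * b) = ψ a * ψ b) ∧
      (∀ a, ψ (QuantumDouble.antipode k _ a) = HopfAlgebra.antipode k (ψ a)) ∧
      (∀ [StarRing k] (a : QuantumDouble k (Bicross k (GroupFactorisation.matchedPair hX))),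
        ψ (star a) = star (ψ a)) := by
  refine ⟨{ QuantumDouble.toBicross hX with
    counit_comp := LinearMap.ext (QuantumDouble.counit_toBicross hX)
    map_comp_comul := LinearMap.ext (QuantumDouble.map_comul_toBicross hX) },
    QuantumDouble.toBicross_tmul hX, QuantumDouble.toBicross_one hX, QuantumDouble.toBicross_mul hX,
    QuantumDouble.toBicross_antipode hX, QuantumDouble.toBicross_star hX⟩
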